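/- A multi-head masked hard-attention transformer over a finite alphabet $\Sigma$, of width $d>0$, depth $k\ge 0$ and with $H\ge 1$ heads, consists of a word embedding $\mathrm{emb}\colon\Sigma\to\mathbb{R}^d$ (no position embedding), $k$ layers applied one after another, and an affine output map $\mathbb{R}^d\to\mathbb{R}$. A layer maps $(x_1,\dots,x_n)\in(\mathbb{R}^d)^n$ to $(y_1,\dots,y_n)$ by $$c_i=x_i+\sum_{h=1}^{H}\mathrm{att}_h(x_1,\dots,x_n)_i,\qquad y_i=\mathrm{ffn}(c_i)+c_i ,$$ where $\mathrm{ffn}$ is a two-layer ReLU network with any number of hidden units, and each head $\mathrm{att}_h$ has a bilinear score function $f_S\colon\mathbb{R}^d\times\mathbb{R}^d\to\mathbb{R}$ and a linear value map $f_V\colon\mathbb{R}^d\to\mathbb{R}^d$. The attention is *future-masked rightmost-hard* if, for every head and every position $i$, the head's output at $i$ is $f_V(x_{j})$, where $j$ is the largest among the positions $j<i$ that maximize $f_S(x_i,x_j)$ over all positions $j<i$, and is $\mathbf 0$ if $i=1$. The transformer accepts a nonempty string $w\in\Sigma^+$ of length $n$ iff the output map applied to the final activation at position $n$ is nonnegative,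 and it recognizes the language of all nonempty strings that it accepts. Let $\mathbf{MUHAT}(\Sigma)_k$ be the class of languages over $\Sigma$ recognized by such transformers of depth $k$ using only future-masked rightmost-hard attention. For $k\ge 1$ let $\mathrm{STAIR}_k$ be the language over $\{a,b,c\}$ of the strings which, after deleting all $c$'s, contain $a^k$ as a (contiguous) substring. **Theorem.** Depth $k+1$ is strictly more expressive than depth $k$, for every $k\ge 0$. Precisely, $\mathbf{MUHAT}(\Sigma)_k\subseteq\mathbf{MUHAT}(\Sigma)_{k+1}$ for every finite alphabet $\Sigma$ and every $k\ge 0$, and for every $k\ge 0$, over $\Sigma=\{a,b,c\}$, $$\mathrm{STAIR}_{k+1}\notin\mathbf{MUHAT}(\Sigma)_k,\qquad \mathrm{STAIR}_{k+1}\in\mathbf{MUHAT}(\Sigma)_{k+1},$$ so that $\mathbf{MUHAT}(\Sigma)_k\subsetneq\mathbf{MUHAT}(\Sigma)_{k+1}$. -/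

import Mathlib

namespace HardAttention

/-- The attention masks: no masking, strict future masking (`j < i`) and strict past masking
(`i < j`). -/
inductive Mask where
  | none
  | future
  | past

/-- `m.Allows i j` says that position `i` may attend to position `j`. -/
def Mask.Allows {n : ℕ} : Mask → Fin n → Fin n → Prop
  | .none, _, _ => True
  | .future, i, j => j < i
  | .past, i, j => i < j

/-- The tie-breaking rules. -/
inductive TieBreak where
  | leftmost
  | rightmost

/-- The element of a nonempty finite set of positions selected by a tie-breaking rule. -/
def TieBreak.choose {n : ℕ} : TieBreak → (I : Finset (Fin n)) → I.Nonempty → Fin n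
  | .leftmost, I, h => I.min' h
  | .rightmost, I, h => I.max' h

/-- A (single-head) hard-attention self-attention layer of width `d`. -/
structure Attention (d : ℕ) where
  score : LinearMap.BilinForm ℝ (Fin d → ℝ)
  mask : Mask
  tie : TieBreak
  value : (Fin d → ℝ) →ₗ[ℝ] (Fin d → ℝ)

namespace Attention

variable {d n : ℕ}

open Classical in
/-- The unmasked positions for position `i`. -/
noncomputable def unmasked (A : Attention d) (i : Fin n) : Finset (Fin n) :=
  Finset.univ.filter fun j => A.mask.Allows i j

open Classical in
/-- The best-scoring unmasked positions for position `i`. -/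
noncomputable def best (A : Attention d) (x : Fin n → Fin d → ℝ) (i : Fin n) : Finset (Fin n) :=
  (A.unmasked i).filter fun j => ∀ j' ∈ A.unmasked i, A.score (x i) (x j') ≤ A.score (x i) (x j)

theorem best_nonempty (A : Attention d) (x : Fin n → Fin d → ℝ) {i : Fin n}
    (h : (A.unmasked i : Finset (Fin n)).Nonempty) : (A.best x i).Nonempty := by
  obtain ⟨j, hj, hmax⟩ := Finset.exists_max_image _ (fun j => A.score (x i) (x j)) h
  exact ⟨j, by simp only [best, Finset.mem_filter]; exact ⟨hj, hmax⟩⟩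

open Classical in
/-- The output of the attention layer: the value at the selected best-scoring unmasked position,
or `0` if every position is masked. -/
noncomputable def eval (A : Attention d) (x : Fin n → Fin d → ℝ) : Fin n → Fin d → ℝ := fun i =>
  if h : (A.unmasked i : Finset (Fin n)).Nonempty then
    A.value (x (A.tie.choose (A.best x i) (A.best_nonempty x h)))
  else 0

/-- The attention layer uses strict future masking and rightmost tie-breaking. -/
def IsFutureRightmost (A : Attention d) : Prop :=
  A.mask = Mask.future ∧ A.tie = TieBreak.rightmost

end Attention

/-- A two-layer feed-forward network with ReLU activations in between, with input and output
dimension `d` and an arbitrary number of hidden units. -/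
structure FeedForward (d : ℕ) where
  hidden : ℕ
  W₁ : Matrix (Fin hidden) (Fin d) ℝ
  b₁ : Fin hidden → ℝ
  W₂ : Matrix (Fin d) (Fin hidden) ℝ
  b₂ : Fin d → ℝ

/-- The function computed by a feed-forward network. -/
noncomputable def FeedForward.eval {d : ℕ} (F : FeedForward d) (x : Fin d → ℝ) : Fin d → ℝ :=
  F.W₂.mulVec (fun r => max 0 ((F.W₁.mulVec x + F.b₁) r)) + F.b₂

/-- A transformer layer of width `d` with `H` attention heads. -/
structure Layer (d H : ℕ) where
  att : Fin H → Attention d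
  ffn : FeedForward d

/-- Multi-head attention with a residual connection: `c = ∑ₕ attₕ(x) + x`. -/
noncomputable def Layer.attend {d H n : ℕ} (L : Layer d H) (x : Fin n → Fin d → ℝ) :
    Fin n → Fin d → ℝ :=
  ∑ h, (L.att h).eval x + x

/-- The whole layer: `yᵢ = ffn(cᵢ) + cᵢ`. -/
noncomputable def Layer.eval {d H n : ℕ} (L : Layer d H) (x : Fin n → Fin d → ℝ) :
    Fin n → Fin d → ℝ :=
  fun i => L.ffn.eval (L.attend x i) + L.attend x i

universe u

/-- A multi-head masked hard-attention transformer over the alphabet `α`, without position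
embeddings, with an output layer (an affine projection to a scalar). The layers are listed from
the first (bottom) to the last (top). -/
structure Transformer (α : Type u) where
  width : ℕ
  width_pos : 0 < width
  heads : ℕ
  heads_pos : 0 < heads
  emb : α → Fin width → ℝ
  layers : List (Layer width heads)
  out : (Fin width → ℝ) →ₗ[ℝ] ℝ
  bias : ℝ

namespace Transformer

variable {α : Type u}

/-- The depth: the number of (attention) layers. -/
def depth (T : Transformer α) : ℕ := T.layers.length

/-- The final activations at all positions on the input `w`. -/
noncomputable def run (T : Transformer α) (w : List α) : Fin w.length → Fin T.width → ℝ :=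
  T.layers.foldl (fun x L => L.eval x) (fun i => T.emb (w.get i))

/-- A nonempty string is accepted iff the output layer is nonnegative at the last position. -/
def Accepts (T : Transformer α) (w : List α) (hw : w ≠ []) : Prop :=
  0 ≤ T.out (T.run w ⟨w.length - 1, Nat.sub_one_lt (List.length_pos_iff.mpr hw).ne'⟩) + T.bias

/-- The language of nonempty strings recognized by a transformer. -/
def language (T : Transformer α) : Language α := {w | ∃ hw : w ≠ [], T.Accepts w hw}

/-- Every attention head of every layer is future-masked and rightmost-hard. -/
def OnlyFutureRightmost (T : Transformer α) : Prop :=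
  ∀ L ∈ T.layers, ∀ h, (L.att h).IsFutureRightmost

end Transformer

/-- The languages over `α` recognized by multi-head masked hard-attention transformers of depth
`k` that use only future-masked rightmost-hard attention. -/
def MUHAT (α : Type u) (k : ℕ) : Set (Language α) :=
  {L | ∃ T : Transformer α, T.depth = k ∧ T.OnlyFutureRightmost ∧ T.language = L}

/-- The three-letter alphabet `{a, b, c}`. -/
inductive Letter where
  | a
  | b
  | c
deriving DecidableEq

/-- The strings over `{a, b, c}` that contain `aᵏ` as a substring (contiguous block) after all
`c`s are deleted. -/
def stair (k : ℕ) : Language Letter :=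
  {w | List.replicate k Letter.a <:+: w.filter (fun s => s ≠ Letter.c)}

end HardAttention

/-!
A layer of future-masked rightmost-hard attention computes the new activation at a position from
the old one and from the list `p` of activations to its left. A head sees of `p` only its rightmost
best entry, and "the better of two candidates, the later one on ties" is an associative idempotent
operation (`better_assoc`, `better_self`). Hence a layer cannot tell `p q q s` from `p q s`
(`Layer.step_repetitionInsensitive`). This is all that the lower bound uses about layers.

**Lower bound.** Let `σ` be the substitution `a ↦ ac`, `b ↦ bac`, `c ↦ c`, and consider words
`bac · σ(w)`. Every image of a letter is a suffix of `bac`, so appending it after `bac` is an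
immediate repetition, and up to such repetitions the left context at the start of every image is
`bac`. A single layer therefore acts on each image in a way that depends only on the letter
(`prefixMap_flatMap_lengthen`): its output is a fixed prefix followed by the concatenation over the
letters of `w` of fixed blocks of activations. The remaining layers see `w` in the guise of these
blocks. Allowing an arbitrary prefix and arbitrary blocks from the start, induction on the depth
gives, from the pair `ac`, `c`, two words whose last activations agree after `k` layers
(`getLast?_runMaps_lengthenIter`). On the other hand `σ`, preceded by `bac`, lengthens the longest
block of `a`s by exactly one, so that only the first word of the pair lies in `stair (k + 1)`
(`lengthenIter_mem_stair`, `lengthenIter_notMem_stair`).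

**Upper bound.** A flag at each position records that the position holds an `a` completing a block
of `m + 1` of them. A layer reads the flag of the nearest letter to the left that is not a `c` and
takes the conjunction, which increases `m` by one (`extendLayer_step`). After `k` such layers, one
further layer searches for a set flag (`rightmostBest_search`).

Inclusion of the classes holds because a layer with zero values and a zero network does nothing.
-/

namespace HardAttention

/-! ### Maps depending on the left context -/

section PrefixMap

variable {X Y : Type*}

/-- Apply `f` to every entry `x` of a list together with the part of the sequence strictly to its
left; `p` is what precedes the whole list. -/
def prefixMap (f : List X → X → Y) : List X → List X → List Y
  | _, [] => []
  | p, x :: l => f p x :: prefixMap f (p ++ [x]) l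

theorem prefixMap_append (f : List X → X → Y) (p l₁ l₂ : List X) :
    prefixMap f p (l₁ ++ l₂) = prefixMap f p l₁ ++ prefixMap f (p ++ l₁) l₂ := by
  induction l₁ generalizing p with
  | nil => simp [prefixMap]
  | cons x l ih => simp [prefixMap, ih]

@[simp]
theorem length_prefixMap (f : List X → X → Y) (p l : List X) :
    (prefixMap f p l).length = l.length := by
  induction l generalizing p with
  | nil => rfl
  | cons x l ih => simp [prefixMap, ih]

theorem getElem_prefixMap (f : List X → X → Y) (p l : List X) (i : ℕ) (hi : i < l.length) :
    (prefixMap f p l)[i]'(by simpa using hi) = f (p ++ l.take i) l[i] := by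
  induction l generalizing p i with
  | nil => simp at hi
  | cons x l ih =>
    cases i with
    | zero => simp [prefixMap]
    | succ i =>
      simp only [prefixMap, List.getElem_cons_succ, List.take_succ_cons]
      rw [ih (p ++ [x]) i (by simpa using hi)]
      simp

theorem prefixMap_congr {f : List X → X → Y} {p p' : List X}
    (h : ∀ s x, f (p ++ s) x = f (p' ++ s) x) (l : List X) :
    prefixMap f p l = prefixMap f p' l := by
  induction l generalizing p p' with
  | nil => rfl
  | cons x l ih =>
    have h0 := h [] x
    simp only [List.append_nil] at h0
    simp only [prefixMap, h0]
    rw [ih (p := p ++ [x]) (p' := p' ++ [x]) fun s y => by simpa using h (x :: s) y]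

theorem prefixMap_eq_map (g : X → Y) (p l : List X) :
    prefixMap (fun _ x => g x) p l = l.map g := by
  induction l generalizing p with
  | nil => rfl
  | cons x l ih => simp [prefixMap, ih]

/-- A function of the left context that does not notice when a factor of the context is
immediately repeated. -/
def RepetitionInsensitive (f : List X → X → Y) : Prop :=
  ∀ p q s x, f (p ++ q ++ q ++ s) x = f (p ++ q ++ s) x

/-- Run a list of context-dependent maps one after another, the head of the list first. -/
def runMaps (fs : List (List X → X → X)) (l : List X) : List X :=
  fs.foldl (fun l f => prefixMap f [] l) l

end PrefixMap

/-! ### The rightmost best entry of a list -/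

section RightmostBest

variable {X : Type*}

/-- The better of two candidates, the second one winning ties. -/
noncomputable def better (g : X → ℝ) : Option X → Option X → Option X
  | o, none => o
  | none, some y => some y
  | some x, some y => if g x ≤ g y then some y else some x

theorem better_assoc (g : X → ℝ) (o₁ o₂ o₃ : Option X) :
    better g (better g o₁ o₂) o₃ = better g o₁ (better g o₂ o₃) := by
  rcases o₁ with _ | x <;> rcases o₂ with _ | y <;> rcases o₃ with _ | z <;> try rfl
  · by_cases h : g y ≤ g z <;> simp [better, h]
  · by_cases h : g x ≤ g y <;> by_cases h' : g y ≤ g z <;> simp [better, h, h']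
    · exact fun h'' => absurd h'' (not_lt.mpr (h.trans h'))
    · exact fun h'' => absurd ((not_le.mp h').trans (not_le.mp h)) (not_lt.mpr h'')

theorem better_self (g : X → ℝ) (o : Option X) : better g o o = o := by
  cases o <;> simp [better]

@[simp]
theorem none_better (g : X → ℝ) (o : Option X) : better g none o = o := by
  cases o <;> rfl

/-- The last among the entries of a list that maximize `g`. -/
noncomputable def rightmostBest (g : X → ℝ) (l : List X) : Option X :=
  l.foldl (fun o x => better g o (some x)) none

@[simp]
theorem rightmostBest_nil (g : X → ℝ) : rightmostBest g [] = none := rfl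

theorem rightmostBest_concat (g : X → ℝ) (l : List X) (x : X) :
    rightmostBest g (l ++ [x]) = better g (rightmostBest g l) (some x) := by
  simp [rightmostBest]

theorem rightmostBest_append (g : X → ℝ) (l₁ l₂ : List X) :
    rightmostBest g (l₁ ++ l₂) = better g (rightmostBest g l₁) (rightmostBest g l₂) := by
  induction l₂ using List.reverseRecOn with
  | nil => simp [better]
  | append_singleton l x ih =>
    rw [← List.append_assoc, rightmostBest_concat, rightmostBest_concat, ih, better_assoc]

theorem mem_of_rightmostBest {g : X → ℝ} {l : List X} {x : X}
    (h : rightmostBest g l = some x) : x ∈ l := by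
  induction l using List.reverseRecOn generalizing x with
  | nil => simp at h
  | append_singleton l y ih =>
    rw [rightmostBest_concat] at h
    rcases ho : rightmostBest g l with _ | z
    · simp_all
    · by_cases hz : g z ≤ g y <;> simp_all [better]

theorem rightmostBest_append_cons {g : X → ℝ} {l₁ l₂ : List X} {y : X}
    (h₁ : ∀ z ∈ l₁, g z ≤ g y) (h₂ : ∀ z ∈ l₂, g z < g y) :
    rightmostBest g (l₁ ++ y :: l₂) = some y := by
  rw [← List.singleton_append, ← List.append_assoc, rightmostBest_append, rightmostBest_concat]
  have h : better g (rightmostBest g l₁) (some y) = some y := by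
    rcases ho : rightmostBest g l₁ with _ | z
    · rfl
    · simp [better, h₁ z (mem_of_rightmostBest ho)]
  rw [h]
  rcases ho : rightmostBest g l₂ with _ | z
  · rfl
  · simp [better, not_le.mpr (h₂ z (mem_of_rightmostBest ho))]

theorem rightmostBest_repeat (g : X → ℝ) (p q s : List X) :
    rightmostBest g (p ++ q ++ q ++ s) = rightmostBest g (p ++ q ++ s) := by
  simp only [rightmostBest_append, better_assoc]
  rw [← better_assoc g (rightmostBest g q) (rightmostBest g q), better_self]

end RightmostBest

/-! ### Layers as maps on lists -/

section Layers

variable {d H n : ℕ}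

/-- The output of a future-masked rightmost-hard head at a position with activation `x` and
earlier activations `p`. -/
noncomputable def Attention.attended (A : Attention d) (p : List (Fin d → ℝ)) (x : Fin d → ℝ) :
    Fin d → ℝ :=
  ((rightmostBest (A.score x) p).map A.value).getD 0

theorem Attention.eval_eq_attended {A : Attention d} (hA : A.IsFutureRightmost)
    (x : Fin n → Fin d → ℝ) (i : Fin n) :
    A.eval x i = A.attended ((List.ofFn x).take i) (x i) := by
  have hmem : ∀ j, j ∈ A.unmasked i ↔ j < i := fun j => by
    simp [Attention.unmasked, hA.1, Mask.Allows]
  by_cases h : (A.unmasked i).Nonempty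
  · rw [Attention.eval, dif_pos h]
    have htie : A.tie.choose (A.best x i) (A.best_nonempty x h) =
        (A.best x i).max' (A.best_nonempty x h) := by
      rw [hA.2]; rfl
    rw [htie]
    have hj := (A.best x i).max'_mem (A.best_nonempty x h)
    have hlast : ∀ k ∈ A.best x i, k ≤ (A.best x i).max' (A.best_nonempty x h) :=
      fun k hk => (A.best x i).le_max' k hk
    generalize (A.best x i).max' (A.best_nonempty x h) = j at hj hlast ⊢
    simp only [Attention.best, Finset.mem_filter, hmem] at hj hlast
    obtain ⟨hji, hmax⟩ := hj
    have hsplit : (List.ofFn x).take i =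
        ((List.ofFn x).take i).take j ++ x j :: ((List.ofFn x).take i).drop (j + 1) := by
      have hlen : (j : ℕ) < ((List.ofFn x).take i).length := by
        simpa using hji
      conv_lhs => rw [← List.take_append_drop j ((List.ofFn x).take i)]
      rw [List.drop_eq_getElem_cons hlen]
      simp
    rw [Attention.attended, hsplit, rightmostBest_append_cons]
    · rfl
    · intro z hz
      obtain ⟨m, hm, rfl⟩ := List.getElem_of_mem hz
      simp only [List.length_take, List.length_ofFn, lt_min_iff] at hm
      simpa using hmax ⟨m, hm.2.2⟩ (Fin.lt_def.mpr hm.2.1)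
    · intro z hz
      obtain ⟨m, hm, rfl⟩ := List.getElem_of_mem hz
      simp only [List.length_drop, List.length_take, List.length_ofFn] at hm
      have hmi : (j : ℕ) + 1 + m < i := by omega
      simp only [List.getElem_drop, List.getElem_take, List.getElem_ofFn]
      by_contra hle
      have hk := hlast ⟨j + 1 + m, by omega⟩
        ⟨Fin.lt_def.mpr hmi, fun j' hj' => (hmax j' hj').trans (not_lt.mp hle)⟩
      have := Fin.le_def.mp hk
      simp only at this
      omega
  · have hi : (i : ℕ) = 0 := by
      by_contra hi
      exact h ⟨⟨0, by omega⟩, (hmem _).mpr (Fin.lt_def.mpr (by simp only; omega))⟩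
    rw [Attention.eval, dif_neg h, hi]
    simp [Attention.attended]

/-- The output of a layer of future-masked rightmost-hard heads at a position with activation `x`
and earlier activations `p`. -/
noncomputable def Layer.step (L : Layer d H) (p : List (Fin d → ℝ)) (x : Fin d → ℝ) :
    Fin d → ℝ :=
  L.ffn.eval (∑ h, (L.att h).attended p x + x) + (∑ h, (L.att h).attended p x + x)

theorem Layer.step_repetitionInsensitive (L : Layer d H) : RepetitionInsensitive L.step := by
  intro p q s x
  simp only [Layer.step, Attention.attended, rightmostBest_repeat]

theorem Layer.ofFn_eval {L : Layer d H} (hL : ∀ h, (L.att h).IsFutureRightmost)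
    (x : Fin n → Fin d → ℝ) :
    List.ofFn (L.eval x) = prefixMap L.step [] (List.ofFn x) := by
  apply List.ext_getElem
  · simp
  · intro i h₁ h₂
    have hi : i < n := by simpa using h₁
    rw [getElem_prefixMap _ _ _ _ (by simpa using hi)]
    simp only [List.getElem_ofFn, List.nil_append, Layer.eval, Layer.attend, Layer.step,
      Pi.add_apply, Finset.sum_apply]
    simp only [fun h => Attention.eval_eq_attended (hL h) x ⟨i, hi⟩]

theorem ofFn_foldl_eval {Ls : List (Layer d H)}
    (hLs : ∀ L ∈ Ls, ∀ h, (L.att h).IsFutureRightmost) (x : Fin n → Fin d → ℝ) :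
    List.ofFn (Ls.foldl (fun x L => L.eval x) x) = runMaps (Ls.map Layer.step) (List.ofFn x) := by
  induction Ls generalizing x with
  | nil => rfl
  | cons L Ls ih =>
    simp only [List.foldl_cons]
    rw [ih (fun L' h' => hLs L' (List.mem_cons_of_mem _ h')),
      Layer.ofFn_eval (hLs L List.mem_cons_self)]
    rfl

universe u in
theorem Transformer.mem_language_iff {α : Type u} {T : Transformer α} (hT : T.OnlyFutureRightmost)
    (w : List α) :
    w ∈ T.language ↔
      ∃ v, (runMaps (T.layers.map Layer.step) (w.map T.emb)).getLast? = some v ∧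
        0 ≤ T.out v + T.bias := by
  have hrun : runMaps (T.layers.map Layer.step) (w.map T.emb) = List.ofFn (T.run w) := by
    rw [Transformer.run, ofFn_foldl_eval hT]
    congr 1
    apply List.ext_getElem <;> simp
  rw [hrun]
  change (∃ hw : w ≠ [], T.Accepts w hw) ↔ _
  have key : ∀ hw : w ≠ [], (List.ofFn (T.run w)).getLast? =
      some (T.run w ⟨w.length - 1, Nat.sub_one_lt (List.length_pos_iff.mpr hw).ne'⟩) := by
    intro hw
    have := List.length_pos_iff.mpr hw
    rw [List.getLast?_eq_getElem?, List.getElem?_eq_getElem (by simp; omega)]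
    simp
  constructor
  · rintro ⟨hw, h⟩
    exact ⟨_, key hw, h⟩
  · rintro ⟨v, hv, h⟩
    have hw : w ≠ [] := by
      rintro rfl
      simp at hv
    rw [key hw, Option.some_inj] at hv
    exact ⟨hw, by rw [Transformer.Accepts, hv]; exact h⟩

end Layers

/-! ### Depth `k` does not recognize `stair (k + 1)` -/

section LowerBound

/-- The substitution `a ↦ ac`, `b ↦ bac`, `c ↦ c`. It prolongs every block of `a`s that follows
a `b` by one, and every image is a suffix of `bac`. -/
def lengthen : Letter → List Letter
  | .a => [.a, .c]
  | .b => [.b, .a, .c]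
  | .c => [.c]

theorem lengthen_suffix (s : Letter) : lengthen s <:+ [.b, .a, .c] := by
  cases s
  · exact ⟨[.b], rfl⟩
  · exact ⟨[], rfl⟩
  · exact ⟨[.b, .a], rfl⟩

/-- Starting from a word, apply `w ↦ bac · lengthen(w)` repeatedly. -/
def lengthenIter (w : List Letter) : ℕ → List Letter
  | 0 => w
  | k + 1 => [.b, .a, .c] ++ (lengthenIter w k).flatMap lengthen

/-- In the context `p₀ · bac`, appending an image `lengthen s` repeats a suffix of the context, so
the context at the start of every image is equivalent to `p₀ · bac`, and `f` acts on each image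
independently of where it stands. -/
theorem prefixMap_flatMap_lengthen {X Y : Type*} {f : List X → X → Y}
    (hf : RepetitionInsensitive f) (emb : Letter → List X) {p₀ p : List X}
    (hp : ∀ s x, f (p ++ s) x = f (p₀ ++ [Letter.b, .a, .c].flatMap emb ++ s) x)
    (w : List Letter) :
    prefixMap f p ((w.flatMap lengthen).flatMap emb) =
      w.flatMap fun s => prefixMap f (p₀ ++ [Letter.b, .a, .c].flatMap emb)
        ((lengthen s).flatMap emb) := by
  induction w generalizing p with
  | nil => rfl
  | cons s w ih =>
    rw [List.flatMap_cons, List.flatMap_append, prefixMap_append, List.flatMap_cons,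
      prefixMap_congr hp, ih]
    intro t x
    obtain ⟨u, hu⟩ := lengthen_suffix s
    rw [List.append_assoc, hp, ← hu, List.flatMap_append]
    simpa using hf (p₀ ++ u.flatMap emb) ((lengthen s).flatMap emb) t x

/-- As many repetition-insensitive maps as there were steps in the construction of the words do not
separate the iterates of `ac` and `c`. The first map turns an iterate into the preceding one, with a
new prefix and new blocks in place of the letters; hence the generality in `p` and `emb`. -/
theorem getLast?_runMaps_lengthenIter {X : Type*} (fs : List (List X → X → X))
    (hfs : ∀ f ∈ fs, RepetitionInsensitive f) (p : List X) (emb : Letter → List X)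
    (hc : emb .c ≠ []) :
    (runMaps fs (p ++ (lengthenIter [.a, .c] fs.length).flatMap emb)).getLast? =
      (runMaps fs (p ++ (lengthenIter [.c] fs.length).flatMap emb)).getLast? := by
  induction fs generalizing p emb with
  | nil =>
    simp only [runMaps, List.length_nil, lengthenIter, List.foldl_nil, List.flatMap_cons,
      List.flatMap_nil, List.append_nil]
    rw [← List.append_assoc, List.getLast?_append_of_ne_nil _ hc,
      List.getLast?_append_of_ne_nil _ hc]
  | cons f fs ih =>
    have hstep : ∀ w : List Letter,
        prefixMap f [] (p ++ ([Letter.b, .a, .c] ++ w.flatMap lengthen).flatMap emb) =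
          prefixMap f [] (p ++ [Letter.b, .a, .c].flatMap emb) ++
            w.flatMap fun s => prefixMap f (p ++ [Letter.b, .a, .c].flatMap emb)
              ((lengthen s).flatMap emb) := by
      intro w
      rw [List.flatMap_append, ← List.append_assoc, prefixMap_append, List.nil_append,
        prefixMap_flatMap_lengthen (hfs f List.mem_cons_self) emb fun _ _ => rfl]
    have := ih (fun g hg => hfs g (List.mem_cons_of_mem _ hg))
      (prefixMap f [] (p ++ [Letter.b, .a, .c].flatMap emb))
      (fun s => prefixMap f (p ++ [Letter.b, .a, .c].flatMap emb) ((lengthen s).flatMap emb))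
      (by
        rw [← List.length_pos_iff, length_prefixMap]
        simpa [lengthen, List.length_pos_iff] using hc)
    rw [← hstep, ← hstep] at this
    exact this

/-- The word with its `c`s deleted. -/
def dropC (w : List Letter) : List Letter := w.filter (fun s => s ≠ Letter.c)

@[simp] theorem dropC_nil : dropC [] = [] := rfl

@[simp] theorem dropC_append (v w : List Letter) : dropC (v ++ w) = dropC v ++ dropC w :=
  List.filter_append ..

@[simp] theorem dropC_cons_a (w : List Letter) : dropC (.a :: w) = .a :: dropC w := rfl

@[simp] theorem dropC_cons_b (w : List Letter) : dropC (.b :: w) = .b :: dropC w := rfl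

@[simp] theorem dropC_cons_c (w : List Letter) : dropC (.c :: w) = dropC w := rfl

theorem mem_stair {k : ℕ} {w : List Letter} :
    w ∈ stair k ↔ List.replicate k Letter.a <:+: dropC w := Iff.rfl

theorem lengthenIter_mem_stair (k : ℕ) : lengthenIter [.a, .c] k ∈ stair (k + 1) := by
  suffices h : List.replicate (k + 1) Letter.a <:+ dropC (lengthenIter [.a, .c] k) from
    mem_stair.mpr h.isInfix
  induction k with
  | zero => exact ⟨[], rfl⟩
  | succ k ih =>
    -- The final block of `a`s grows by one, because the leading `bac` and the image of every `b`
    -- contribute an `a` just before the images of the letters that follow.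
    have hlen : ∀ (m : ℕ) (w : List Letter), List.replicate m Letter.a <:+ dropC w →
        List.replicate (m + 1) Letter.a <:+
          dropC ([.b, .a, .c] ++ w.flatMap lengthen) := by
      intro m w
      induction w using List.reverseRecOn generalizing m with
      | nil =>
        intro h
        have : m = 0 := by simpa using h.length_le
        subst this
        exact ⟨[.b], rfl⟩
      | append_singleton w s ih =>
        intro h
        cases m with
        | zero =>
          rw [List.flatMap_append, ← List.append_assoc, dropC_append]
          cases s
          · exact List.suffix_append _ _
          · exact (List.suffix_append [Letter.b] [Letter.a]).trans (List.suffix_append _ _)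
          · simpa [lengthen] using ih 0 (List.nil_suffix)
        | succ m =>
          rw [List.replicate_succ'] at h ⊢
          rw [List.flatMap_append, ← List.append_assoc, dropC_append]
          rw [dropC_append] at h
          cases s
          · have h' : List.replicate m Letter.a <:+ dropC w := by
              simpa [List.suffix_append_inj_of_length_eq] using h
            obtain ⟨t, ht⟩ := ih m h'
            exact ⟨t, by rw [← ht]; simp [lengthen]⟩
          · obtain ⟨t, ht⟩ := h
            have := congrArg List.getLast? ht
            simp at this
          · have h' : List.replicate (m + 1) Letter.a <:+ dropC w := by
              rw [List.replicate_succ']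
              simpa using h
            have := ih (m + 1) h'
            rw [List.replicate_succ'] at this
            simpa [lengthen] using this
    exact hlen _ _ ih

/-- Every block of `a`s in `a ^ r` followed by the given word, disregarding `c`s, has length at
most `k`. -/
def RunsLE (k : ℕ) : ℕ → List Letter → Prop
  | r, [] => r ≤ k
  | r, .a :: w => RunsLE k (r + 1) w
  | r, .b :: w => r ≤ k ∧ RunsLE k 0 w
  | r, .c :: w => RunsLE k r w

theorem RunsLE.lengthen {k r : ℕ} {w : List Letter} (h : RunsLE k r w) :
    RunsLE (k + 1) (r + 1) (w.flatMap lengthen) := by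
  induction w generalizing r with
  | nil => exact Nat.succ_le_succ h
  | cons s w ih =>
    cases s
    · exact ih (r := r + 1) h
    · exact ⟨Nat.succ_le_succ h.1, ih (r := 0) h.2⟩
    · exact ih (r := r) h

theorem RunsLE.not_infix {k r : ℕ} {w : List Letter} (h : RunsLE k r w) :
    ¬ List.replicate (k + 1) Letter.a <:+: List.replicate r Letter.a ++ dropC w := by
  have hr : ∀ {r}, r ≤ k →
      ¬ List.replicate (k + 1) Letter.a <:+: List.replicate r Letter.a := by
    intro r hr hi
    have := hi.length_le
    simp at this
    omega
  induction w generalizing r with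
  | nil => simpa using hr h
  | cons s w ih =>
    cases s
    · have := ih (r := r + 1) h
      rwa [List.replicate_succ' (n := r), List.append_assoc] at this
    · -- An infix without `b` lies on one side of the `b`.
      have hw : ¬ List.replicate (k + 1) Letter.a <:+: dropC w := by simpa using ih (r := 0) h.2
      rw [dropC_cons_b, List.infix_append_iff, List.infix_cons_iff]
      rintro (hi | (hi | hi) | ⟨l₁, l₂, hl, h₁, h₂⟩)
      · exact hr h.1 hi
      · simp [List.replicate_succ] at hi
      · exact hw hi
      · cases l₂ with
        | nil =>
          rw [List.append_nil] at hl
          exact hr h.1 (hl ▸ h₁.isInfix)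
        | cons s t =>
          have hs : s = .b := (List.cons_prefix_cons.mp h₂).1
          have : Letter.b ∈ List.replicate (k + 1) Letter.a := by simp [hl, hs]
          simp at this
    · exact ih (r := r) h

theorem lengthenIter_notMem_stair (k : ℕ) : lengthenIter [.c] k ∉ stair (k + 1) := by
  suffices h : RunsLE k 0 (lengthenIter [.c] k) from fun hm =>
    h.not_infix (by simpa using mem_stair.mp hm)
  induction k with
  | zero => exact Nat.le_refl 0
  | succ k ih => exact ⟨Nat.zero_le _, ih.lengthen⟩

theorem stair_notMem_MUHAT (k : ℕ) : stair (k + 1) ∉ MUHAT Letter k := by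
  rintro ⟨T, hk, hT, hL⟩
  have hmap : ∀ w : List Letter, w.map T.emb = [] ++ w.flatMap fun s => [T.emb s] := by
    intro w
    induction w <;> simp_all
  have hlen : (T.layers.map Layer.step).length = k := by
    rw [List.length_map]; exact hk
  have key := getLast?_runMaps_lengthenIter (T.layers.map Layer.step)
    (by
      intro f hf
      obtain ⟨L, -, rfl⟩ := List.mem_map.mp hf
      exact L.step_repetitionInsensitive)
    [] (fun s => [T.emb s]) (by simp)
  rw [hlen, ← hmap, ← hmap] at key
  have hpos := lengthenIter_mem_stair k
  rw [← hL, Transformer.mem_language_iff hT, key, ← Transformer.mem_language_iff hT, hL] at hpos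
  exact lengthenIter_notMem_stair k hpos

end LowerBound

/-! ### Adding a layer -/

/-- A head that attends but returns zero. -/
noncomputable def zeroHead (d : ℕ) : Attention d := ⟨0, .future, .rightmost, 0⟩

/-- The feed-forward network computing zero. -/
def zeroFFN (d : ℕ) : FeedForward d := ⟨0, 0, 0, 0, 0⟩

@[simp]
theorem zeroFFN_eval {d : ℕ} (x : Fin d → ℝ) : (zeroFFN d).eval x = 0 := by
  ext i
  simp [zeroFFN, FeedForward.eval, Matrix.mulVec, dotProduct]

theorem MUHAT_subset_succ (α : Type*) (k : ℕ) : MUHAT α k ⊆ MUHAT α (k + 1) := by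
  rintro _ ⟨T, hk, hT, rfl⟩
  let L : Layer T.width T.heads := ⟨fun _ => zeroHead _, zeroFFN _⟩
  let T' : Transformer α := { T with layers := T.layers ++ [L] }
  have hL : ∀ n (x : Fin n → Fin T.width → ℝ), L.eval x = x := by
    intro n x
    funext i
    simp [Layer.eval, Layer.attend, L, zeroHead, Attention.eval]
  have hrun : ∀ w, T'.run w = T.run w := by
    intro w
    simp [Transformer.run, T', hL]
  refine ⟨T', by simpa [Transformer.depth, T'] using hk, ?_, ?_⟩
  · intro L' hL' h
    rcases List.mem_append.mp hL' with h' | h'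
    · exact hT L' h' h
    · rw [List.mem_singleton.mp h']
      exact ⟨rfl, rfl⟩
  · ext w
    change (∃ hw : w ≠ [], T'.Accepts w hw) ↔ (∃ hw : w ≠ [], T.Accepts w hw)
    simp only [Transformer.Accepts, hrun]
    rfl

/-! ### Depth `k + 1` recognizes `stair (k + 1)` -/

section UpperBound

/-- The letter `s` is an `a` and, once the `c`s are deleted, completes a block `a ^ (m + 1)` with
the left context `p`. -/
def BlockEnds (m : ℕ) (p : List Letter) (s : Letter) : Prop :=
  s = .a ∧ List.replicate m Letter.a <:+ dropC p

theorem blockEnds_succ {m : ℕ} {p : List Letter} {s : Letter} :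
    BlockEnds (m + 1) p s ↔ BlockEnds m p s ∧ List.replicate (m + 1) Letter.a <:+ dropC p := by
  have : List.replicate (m + 1) Letter.a <:+ dropC p → List.replicate m Letter.a <:+ dropC p :=
    (List.suffix_cons Letter.a _).trans
  unfold BlockEnds
  tauto

theorem replicate_suffix_dropC_concat_iff {m : ℕ} {p : List Letter} {s : Letter} (hs : s ≠ .c) :
    List.replicate (m + 1) Letter.a <:+ dropC (p ++ [s]) ↔ BlockEnds m p s := by
  have hd : dropC [s] = [s] := by cases s <;> simp at hs ⊢
  rw [dropC_append, hd, List.suffix_concat_iff, List.replicate_succ']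
  constructor
  · rintro (h | ⟨t, ht, h⟩)
    · simp at h
    · obtain ⟨rfl, hs⟩ := List.append_inj' ht rfl
      exact ⟨(List.singleton_inj.mp hs).symm, h⟩
  · rintro ⟨rfl, h⟩
    exact Or.inr ⟨_, rfl, h⟩

theorem replicate_infix_dropC_concat_iff {m : ℕ} {p : List Letter} {s : Letter} :
    List.replicate (m + 1) Letter.a <:+: dropC (p ++ [s]) ↔
      BlockEnds m p s ∨ List.replicate (m + 1) Letter.a <:+: dropC p := by
  by_cases hs : s = .c
  · subst hs
    simp [BlockEnds]
  · rw [← replicate_suffix_dropC_concat_iff hs]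
    have hd : dropC [s] = [s] := by cases s <;> simp at hs ⊢
    rw [dropC_append, hd, List.infix_concat_iff]

open Classical in
/-- The activation of the recognizer after `m` layers at a letter `s` with left context `p`: a
constant, a flag for letters other than `c`, and a flag for `BlockEnds m p s`. -/
noncomputable def stairState (m : ℕ) (p : List Letter) (s : Letter) : Fin 3 → ℝ :=
  ![1, if s = .c then 0 else 1, if BlockEnds m p s then 1 else 0]

/-- The head with score `x₀ y_t` and value `y ↦ (0, 0, y₂)`. As `x₀ = 1` in every `stairState`, it
reads the last flag at the rightmost position maximizing `y_t`. -/
noncomputable def flagHead (t : Fin 3) : Attention 3 where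
  score := LinearMap.BilinForm.linMulLin (LinearMap.proj 0) (LinearMap.proj t)
  mask := .future
  tie := .rightmost
  value := (LinearMap.single ℝ (fun _ : Fin 3 => ℝ) 2).comp (LinearMap.proj 2)

/-- The network `x ↦ (0, 0, max 0 (x₂ - 1) - max 0 x₂)`. With the residual connection it maps a
sum `x₂` of two flags to their conjunction. -/
def conjFFN : FeedForward 3 where
  hidden := 2
  W₁ := !![0, 0, 1; 0, 0, 1]
  b₁ := ![-1, 0]
  W₂ := !![0, 0; 0, 0; 1, -1]
  b₂ := 0

/-- The layer passing from blocks of length `m + 1` to blocks of length `m + 2`. -/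
noncomputable def extendLayer : Layer 3 1 := ⟨fun _ => flagHead 1, conjFFN⟩

/-- The layer searching for a position whose flag is set. -/
noncomputable def searchLayer : Layer 3 1 := ⟨fun _ => flagHead 2, zeroFFN 3⟩

/-- The recognizer of `stair (k + 1)`. -/
noncomputable def stairTransformer (k : ℕ) : Transformer Letter where
  width := 3
  width_pos := by norm_num
  heads := 1
  heads_pos := by norm_num
  emb := stairState 0 []
  layers := List.replicate k extendLayer ++ [searchLayer]
  out := LinearMap.proj 2
  bias := -1

theorem flagHead_score (t : Fin 3) (x y : Fin 3 → ℝ) : (flagHead t).score x y = x 0 * y t := rfl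

theorem flagHead_attended (t : Fin 3) (p : List (Fin 3 → ℝ)) (x : Fin 3 → ℝ) :
    (flagHead t).attended p x =
      ![0, 0, ((rightmostBest ((flagHead t).score x) p).map fun y => y 2).getD 0] := by
  rw [Attention.attended]
  rcases rightmostBest ((flagHead t).score x) p with _ | y
  · ext i; fin_cases i <;> simp
  · ext i; fin_cases i <;> simp [flagHead]

theorem conjFFN_eval (x : Fin 3 → ℝ) :
    conjFFN.eval x = ![0, 0, max 0 (x 2 - 1) - max 0 (x 2)] := by
  have h : conjFFN.eval x = (!![0, 0; 0, 0; 1, -1] : Matrix (Fin 3) (Fin 2) ℝ).mulVec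
      (fun r => max 0 (((!![0, 0, 1; 0, 0, 1] : Matrix (Fin 2) (Fin 3) ℝ).mulVec x +
        (![-1, 0] : Fin 2 → ℝ) : Fin 2 → ℝ) r)) + 0 := rfl
  rw [h]
  ext i
  fin_cases i <;>
    simp [dotProduct, Fin.sum_univ_succ, sub_eq_add_neg]

open Classical in
/-- The head of `extendLayer` reads the flag of the nearest letter to the left that is not `c`. -/
theorem rightmostBest_extend (m : ℕ) {g : (Fin 3 → ℝ) → ℝ} (hg : ∀ y, g y = y 1)
    (p : List Letter) :
    ((rightmostBest g (prefixMap (stairState m) [] p)).map fun y => y 2).getD 0 =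
      if List.replicate (m + 1) Letter.a <:+ dropC p then 1 else 0 := by
  -- Before the first letter other than `c`, the head may read a `c`, whose flag is zero.
  suffices h : (dropC p = [] ∧ ∀ y, rightmostBest g (prefixMap (stairState m) [] p) = some y →
        y 1 = 0 ∧ y 2 = 0) ∨
      ∃ y, rightmostBest g (prefixMap (stairState m) [] p) = some y ∧ y 1 = 1 ∧
        y 2 = if List.replicate (m + 1) Letter.a <:+ dropC p then 1 else 0 by
    rcases h with ⟨hp, h⟩ | ⟨y, h, -, hy⟩
    · rw [hp, if_neg (by simp)]
      rcases ho : rightmostBest g (prefixMap (stairState m) [] p) with _ | y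
      · rfl
      · exact (h y ho).2
    · rw [h]
      exact hy
  induction p using List.reverseRecOn with
  | nil => exact Or.inl ⟨rfl, by simp [prefixMap]⟩
  | append_singleton p s ih =>
    have hcat : prefixMap (stairState m) [] (p ++ [s]) =
        prefixMap (stairState m) [] p ++ [stairState m p s] := by
      rw [prefixMap_append]; rfl
    rw [hcat, rightmostBest_concat]
    by_cases hs : s = .c
    · subst hs
      rcases ih with ⟨hp, h⟩ | ⟨y, h, h1, h2⟩
      · left
        refine ⟨by simp [hp], ?_⟩
        rcases ho : rightmostBest g (prefixMap (stairState m) [] p) with _ | y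
        · simp [stairState, BlockEnds]
        · simp [better, hg, (h y ho).1, stairState, BlockEnds]
      · right
        refine ⟨y, ?_, h1, by simpa using h2⟩
        simp [h, better, hg, h1, stairState]
    · right
      refine ⟨stairState m p s, ?_, by simp [stairState, hs],
        by simp only [replicate_suffix_dropC_concat_iff hs]; rfl⟩
      rcases ih with ⟨hp, h⟩ | ⟨y, h, h1, h2⟩
      · rcases ho : rightmostBest g (prefixMap (stairState m) [] p) with _ | y
        · rfl
        · simp [better, hg, (h y ho).1, stairState, hs]
      · simp [h, better, hg, h1, stairState, hs]

open Classical in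
/-- The head of `searchLayer` finds a set flag to the left if there is one. -/
theorem rightmostBest_search (m : ℕ) {g : (Fin 3 → ℝ) → ℝ} (hg : ∀ y, g y = y 2)
    (p : List Letter) :
    ((rightmostBest g (prefixMap (stairState m) [] p)).map fun y => y 2).getD 0 =
      if List.replicate (m + 1) Letter.a <:+: dropC p then 1 else 0 := by
  induction p using List.reverseRecOn with
  | nil => simp [prefixMap]
  | append_singleton p s ih =>
    have hcat : prefixMap (stairState m) [] (p ++ [s]) =
        prefixMap (stairState m) [] p ++ [stairState m p s] := by
      rw [prefixMap_append]; rfl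
    have hbetter : ∀ (o : Option (Fin 3 → ℝ)) (z : Fin 3 → ℝ), 0 ≤ z 2 →
        ((better g o (some z)).map fun y => y 2).getD 0 =
          max ((o.map fun y => y 2).getD 0) (z 2) := by
      rintro (_ | y) z hz
      · simp [better, hz]
      · by_cases h : y 2 ≤ z 2
        · simp [better, hg, h]
        · simp [better, hg, h, (not_le.mp h).le]
    have hval : stairState m p s 2 = if BlockEnds m p s then 1 else 0 := rfl
    rw [hcat, rightmostBest_concat, hbetter _ _ (by rw [hval]; split_ifs <;> simp), ih, hval]
    simp only [replicate_infix_dropC_concat_iff]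
    by_cases h₁ : List.replicate (m + 1) Letter.a <:+: dropC p <;>
      by_cases h₂ : BlockEnds m p s <;> simp [h₁, h₂]

theorem extendLayer_step (m : ℕ) (p : List Letter) (s : Letter) :
    extendLayer.step (prefixMap (stairState m) [] p) (stairState m p s) =
      stairState (m + 1) p s := by
  classical
  have hatt : (flagHead 1).attended (prefixMap (stairState m) [] p) (stairState m p s) =
      ![0, 0, if List.replicate (m + 1) Letter.a <:+ dropC p then 1 else 0] := by
    rw [flagHead_attended, rightmostBest_extend m fun y => by simp [flagHead_score, stairState]]
  have hstep : ∀ q x, extendLayer.step q x =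
      conjFFN.eval ((flagHead 1).attended q x + x) + ((flagHead 1).attended q x + x) :=
    fun q x => by simp [Layer.step, extendLayer]
  rw [hstep, hatt, conjFFN_eval]
  simp only [stairState, blockEnds_succ]
  by_cases h₁ : List.replicate (m + 1) Letter.a <:+ dropC p <;>
    by_cases h₂ : BlockEnds m p s <;>
      ext i <;> fin_cases i <;> simp [h₁, h₂]

theorem prefixMap_extendLayer (m : ℕ) (w : List Letter) :
    prefixMap extendLayer.step [] (prefixMap (stairState m) [] w) =
      prefixMap (stairState (m + 1)) [] w := by
  induction w using List.reverseRecOn with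
  | nil => rfl
  | append_singleton w s ih =>
    rw [prefixMap_append, prefixMap_append, ih, prefixMap_append]
    simp [prefixMap, extendLayer_step]

theorem runMaps_extendLayer (m k : ℕ) (w : List Letter) :
    runMaps (List.replicate k extendLayer.step) (prefixMap (stairState m) [] w) =
      prefixMap (stairState (m + k)) [] w := by
  induction k generalizing m with
  | zero => rfl
  | succ k ih =>
    rw [runMaps, List.replicate_succ, List.foldl_cons, prefixMap_extendLayer, ← runMaps, ih,
      Nat.add_right_comm, Nat.add_assoc]

theorem map_stairState (w : List Letter) :
    w.map (stairState 0 []) = prefixMap (stairState 0) [] w := by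
  rw [← prefixMap_eq_map _ []]
  congr 1
  funext p s
  simp [stairState, BlockEnds]

theorem stair_mem_MUHAT (k : ℕ) : stair (k + 1) ∈ MUHAT Letter (k + 1) := by
  classical
  have hT : (stairTransformer k).OnlyFutureRightmost := by
    intro L hL h
    rcases List.mem_append.mp hL with h' | h'
    · rw [List.eq_of_mem_replicate h']
      exact ⟨rfl, rfl⟩
    · rw [List.mem_singleton.mp h']
      exact ⟨rfl, rfl⟩
  refine ⟨stairTransformer k, ?_, hT, ?_⟩
  · simp [Transformer.depth, stairTransformer]
  ext w
  have hrun : runMaps ((stairTransformer k).layers.map Layer.step)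
      (w.map (stairTransformer k).emb) =
        prefixMap searchLayer.step [] (prefixMap (stairState k) [] w) := by
    have h := runMaps_extendLayer 0 k w
    rw [Nat.zero_add, ← map_stairState] at h
    rw [← h]
    simp [stairTransformer, runMaps]
  have hmem : w ∈ (stairTransformer k).language ↔ ∃ v : Fin 3 → ℝ,
      (prefixMap searchLayer.step [] (prefixMap (stairState k) [] w)).getLast? = some v ∧
        0 ≤ v 2 + -1 := by
    rw [Transformer.mem_language_iff hT, hrun]
    rfl
  rw [hmem, mem_stair]
  rcases List.eq_nil_or_concat' w with rfl | ⟨p, s, rfl⟩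
  · simp [prefixMap]
  have hlast : prefixMap searchLayer.step [] (prefixMap (stairState k) [] (p ++ [s])) =
      prefixMap searchLayer.step [] (prefixMap (stairState k) [] p) ++
        [searchLayer.step (prefixMap (stairState k) [] p) (stairState k p s)] := by
    rw [prefixMap_append, prefixMap_append]
    rfl
  have hatt : (flagHead 2).attended (prefixMap (stairState k) [] p) (stairState k p s) =
      ![0, 0, if List.replicate (k + 1) Letter.a <:+: dropC p then 1 else 0] := by
    rw [flagHead_attended, rightmostBest_search k fun y => by simp [flagHead_score, stairState]]
  have hstep : ∀ q x, searchLayer.step q x = (flagHead 2).attended q x + x :=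
    fun q x => by simp [Layer.step, searchLayer]
  rw [hlast, List.getLast?_concat, replicate_infix_dropC_concat_iff, hstep, hatt]
  simp only [Option.some_inj, exists_eq_left', stairState]
  by_cases h₁ : List.replicate (k + 1) Letter.a <:+: dropC p <;>
    by_cases h₂ : BlockEnds k p s <;> simp [h₁, h₂]

end UpperBound

end HardAttention

theorem mainTheorem10 :
    (∀ (α : Type*) [Finite α] (k : ℕ), HardAttention.MUHAT α k ⊆ HardAttention.MUHAT α (k + 1)) ∧
    ∀ k : ℕ,
      HardAttention.stair (k + 1) ∉ HardAttention.MUHAT HardAttention.Letter k ∧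
      HardAttention.stair (k + 1) ∈ HardAttention.MUHAT HardAttention.Letter (k + 1) ∧
      HardAttention.MUHAT HardAttention.Letter k ⊂
        HardAttention.MUHAT HardAttention.Letter (k + 1) := by
  refine ⟨fun α _ k => HardAttention.MUHAT_subset_succ α k, fun k => ?_⟩
  have h₁ := HardAttention.stair_notMem_MUHAT k
  have h₂ := HardAttention.stair_mem_MUHAT k
  exact ⟨h₁, h₂, HardAttention.MUHAT_subset_succ _ k, fun h => h₁ (h h₂)⟩
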